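/- **Setting and notation.** Let $n\ge 1$, let $f(m)=e^{m}/(1+e^{m})$ be the inverse logit function, and let $\mathbf J$ be the $n\times n$ all-ones matrix. For $n\times n$ real matrices put $d^2(B,C)=n^{-2}\|B-C\|_F^2$, $\|B\|_\infty=\max_{i,j}|b_{ij}|$, let $\|B\|_*$ be the nuclear norm and $r_B$ the rank of $B$, and $B^\dagger=(b_{ij}^{-1})$. Write $a\wedge b=\min\{a,b\}$ and $x_+=\max\{x,0\}$. Let $M_\star=\mu_\star \mathbf J+Z_\star$ with $\sum_{i,j}z_{\star,ij}=0$, $|\mu_\star|\le\alpha_1$, $\|Z_\star\|_\infty\le\alpha_2$; let $\Theta_\star=(\theta_{\star,ij})$ with $\theta_{\star,ij}=f(m_{\star,ij})$, and let $\theta_L>0$ satisfy $\theta_L\le\min_{i,j}\theta_{\star,ij}$. The indicators $w_{ij}$ ($1\le i,j\le n$) are independent, with $w_{ij}$ Bernoulli of success probability $\theta_{\star,ij}$. The log-likelihood is $$\ell_W(M)=\sum_{i,j}\left[\mathbb I_{[w_{ij}=1]}\log f(m_{ij})+\mathbb I_{[w_{ij}=0]}\log\{1-f(m_{ij})\}\right].$$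 For $\beta\ge0$ let $T_\beta(b)=b$ if $|b|\le\beta$, $T_\beta(b)=\beta$ if $b>\beta$ and $T_\beta(b)=-\beta$ if $b<-\beta$; $\mathcal T_\beta$ applies $T_\beta$ entrywise (winsorization). Let $N_\beta$ be the number of pairs $(i,j)$ with $|z_{\star,ij}|>\beta$. Let $(\hat\mu,\hat Z)$ maximize $\ell_W(\mu \mathbf J+Z)$ over all $(\mu,Z)\in\mathbb R\times\mathbb R^{n\times n}$ with $|\mu|\le\alpha_1$, $\|Z\|_\infty\le\alpha_2$, $\|Z\|_*\le\alpha_2\sqrt{r_{Z_\star}n^2}$ and $\sum_{i,j}z_{ij}=0$. Let $\hat Z_\beta$ maximize $\ell_W(\hat\mu \mathbf J+Z)$ over all $Z\in\mathbb R^{n\times n}$ with $\|Z\|_\infty\le\beta$ and $\|Z\|_*\le\beta\sqrt{r_{\mathcal T_\beta(Z_\star)}n^2}$. Put $\hat M_\beta=\hat\mu \mathbf J+\hat Z_\beta$ and $\hat\Theta_\beta=(f(\hat m_{\beta,ij}))$. Finally let $$h_{\alpha_1,\beta}=(1+e^{\alpha_1+\beta})^{-1},\qquad \Gamma_n=e^{\alpha_1+\alpha_2}\left(\alpha_1+\alpha_2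 r_{Z_\star}^{1/2}\right)n^{-1/2},\qquad \widetilde\Gamma_n=h_{\alpha_1,\beta}^{-1}\left(\alpha_1+\beta r_{\mathcal T_\beta(Z_\star)}^{1/2}\right)n^{-1/2},$$ $$\Lambda_n=\min\left[\beta^2,\ \widetilde\Gamma_n+h_{\alpha_1,\beta}^{-1}n^{-2}\beta\left\{8N_\beta+(n^2-N_\beta)|\mu_\star-\hat\mu|\right\}\right].$$ **Theorem.** There exist absolute positive constants $C_1,C_2,C_3$ such that, in every such setting, with probability at least $1-2C_1/n$ the following three inequalities hold simultaneously: $$d^2\{\hat Z_\beta,\mathcal T_\beta(Z_\star)\}\le C_3\Lambda_n,$$ $$d^2(\hat M_\beta,M_\star)\le C_2(\alpha_1^2\wedge\Gamma_n)+C_3\Lambda_n+\frac{2(\alpha_2-\beta)_+^2N_\beta}{n^2},$$ $$d^2(\hat\Theta_\beta^\dagger,\Theta_\star^\dagger)\le\frac{C_2}{h_{\alpha_1,\beta}^2}(\alpha_1^2\wedge\Gamma_n)+\frac{C_3\Lambda_n}{h_{\alpha_1,\beta}^2}+\frac{8N_\beta}{n^2\theta_L^2}.$$ -/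

import Mathlib

open MeasureTheory ProbabilityTheory

namespace LowRankMissing

noncomputable section

/-- The nuclear norm of a square matrix: the sum of its singular values. -/
def nuclearNorm {n : ℕ} (A : Matrix (Fin n) (Fin n) ℝ) : ℝ :=
  ∑ k ∈ Finset.range n, (Matrix.toEuclideanLin A).singularValues k

/-- The average squared distance `d²(B, C) = ‖B - C‖_F² / n²`. -/
def avgSqDist {n : ℕ} (B C : Matrix (Fin n) (Fin n) ℝ) : ℝ :=
  (∑ i, ∑ j, (B i j - C i j) ^ 2) / (n : ℝ) ^ 2

/-- The linear predictor `μ J + Z`, where `J` is the all-ones matrix. -/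
def predictor {n : ℕ} (μ : ℝ) (Z : Matrix (Fin n) (Fin n) ℝ) : Matrix (Fin n) (Fin n) ℝ :=
  μ • Matrix.of (fun _ _ => (1 : ℝ)) + Z

/-- The observation probabilities `Θ = (f(m_ij))` with the inverse logit link
`f(m) = e^m / (1 + e^m)`, which is `Real.sigmoid`. -/
def obsProb {n : ℕ} (M : Matrix (Fin n) (Fin n) ℝ) : Matrix (Fin n) (Fin n) ℝ :=
  M.map Real.sigmoid

/-- The entrywise inverse `B† = (b_ij⁻¹)`. -/
def entrywiseInv {n : ℕ} (B : Matrix (Fin n) (Fin n) ℝ) : Matrix (Fin n) (Fin n) ℝ :=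
  B.map (fun b => b⁻¹)

/-- The Bernoulli log-likelihood `ℓ_W(M)` of the indicator matrix `W`. -/
def logLik {n : ℕ} (W M : Matrix (Fin n) (Fin n) ℝ) : ℝ :=
  ∑ i, ∑ j, ((if W i j = 1 then Real.log (Real.sigmoid (M i j)) else 0)
    + (if W i j = 0 then Real.log (1 - Real.sigmoid (M i j)) else 0))

/-- The scalar winsorizing operator `T_β`. -/
def winsorize (β b : ℝ) : ℝ :=
  if b > β then β else if b < -β then -β else b

/-- The entrywise winsorizing operator `𝒯_β`. -/
def winsorizeMat {n : ℕ} (β : ℝ) (B : Matrix (Fin n) (Fin n) ℝ) : Matrix (Fin n) (Fin n) ℝ :=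
  B.map (winsorize β)

/-- `N_β`: the number of entries of `Z` that lie outside `[-β, β]`. -/
def numExtreme {n : ℕ} (β : ℝ) (Z : Matrix (Fin n) (Fin n) ℝ) : ℕ :=
  (Finset.univ.filter (fun p : Fin n × Fin n => Z p.1 p.2 > β ∨ Z p.1 p.2 < -β)).card

/-- The constraint set for `(μ, Z)`: `|μ| ≤ α₁`, `‖Z‖_∞ ≤ α₂`, `‖Z‖_* ≤ α₂ √(r n n)`,
and the entries of `Z` sum to zero. -/
def jointConstraint (n r : ℕ) (α₁ α₂ : ℝ) : Set (ℝ × Matrix (Fin n) (Fin n) ℝ) :=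
  {p | |p.1| ≤ α₁ ∧ (∀ i j, |p.2 i j| ≤ α₂) ∧
    nuclearNorm p.2 ≤ α₂ * √((r : ℝ) * n * n) ∧ ∑ i, ∑ j, p.2 i j = 0}

/-- The constraint set for the re-estimation of `Z` at level `β`: `‖Z‖_∞ ≤ β` and
`‖Z‖_* ≤ β √(r n n)`. -/
def reConstraint (n r : ℕ) (β : ℝ) : Set (Matrix (Fin n) (Fin n) ℝ) :=
  {Z | (∀ i j, |Z i j| ≤ β) ∧ nuclearNorm Z ≤ β * √((r : ℝ) * n * n)}

/-- `(μ, Z)` is a constrained maximum likelihood estimate of `(μ⋆, Z⋆)` from `W`. -/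
def IsJointMLE {n : ℕ} (r : ℕ) (α₁ α₂ : ℝ) (W : Matrix (Fin n) (Fin n) ℝ)
    (μ : ℝ) (Z : Matrix (Fin n) (Fin n) ℝ) : Prop :=
  (μ, Z) ∈ jointConstraint n r α₁ α₂ ∧
    IsMaxOn (fun p : ℝ × Matrix (Fin n) (Fin n) ℝ => logLik W (predictor p.1 p.2))
      (jointConstraint n r α₁ α₂) (μ, Z)

/-- `Z` is a re-estimate at level `β`, the fitted mean `μ` being kept. -/
def IsReMLE {n : ℕ} (r : ℕ) (β : ℝ) (W : Matrix (Fin n) (Fin n) ℝ)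
    (μ : ℝ) (Z : Matrix (Fin n) (Fin n) ℝ) : Prop :=
  Z ∈ reConstraint n r β ∧
    IsMaxOn (fun Z' => logLik W (predictor μ Z')) (reConstraint n r β) Z

/-- `h_{α₁,β} = (1 + e^{α₁+β})⁻¹`. -/
def hCoef (α₁ β : ℝ) : ℝ := (1 + Real.exp (α₁ + β))⁻¹

/-- `Γ_n = e^{α₁+α₂} (α₁ + α₂ r^{1/2}) n^{-1/2}`, with `r` the rank of `Z⋆`. -/
def Gam (n : ℕ) (α₁ α₂ : ℝ) (Zstar : Matrix (Fin n) (Fin n) ℝ) : ℝ :=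
  Real.exp (α₁ + α₂) * (α₁ + α₂ * √(Zstar.rank : ℝ)) / √(n : ℝ)

/-- `Γ̃_n = h⁻¹ (α₁ + β r^{1/2}) n^{-1/2}`, with `r` the rank of `𝒯_β(Z⋆)`. -/
def GamTilde (n : ℕ) (α₁ β : ℝ) (Zstar : Matrix (Fin n) (Fin n) ℝ) : ℝ :=
  (hCoef α₁ β)⁻¹ * (α₁ + β * √((winsorizeMat β Zstar).rank : ℝ)) / √(n : ℝ)

/-- `Λ_n = min[β², Γ̃_n + h⁻¹ n⁻² β {8 N_β + (n² - N_β) |μ⋆ - μ̂|}]`. -/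
def Lam (n : ℕ) (α₁ β μstar μhat : ℝ) (Zstar : Matrix (Fin n) (Fin n) ℝ) : ℝ :=
  min (β ^ 2)
    (GamTilde n α₁ β Zstar +
      (hCoef α₁ β)⁻¹ * ((n : ℝ) ^ 2)⁻¹ * β *
        (8 * (numExtreme β Zstar : ℝ)
          + ((n : ℝ) ^ 2 - (numExtreme β Zstar : ℝ)) * |μstar - μhat|))

end

end LowRankMissing

/-! The only random input is the noise `W - Θ⋆`: by `measure_opNorm_le`, its operator norm is at
most `16 √n` outside an event of probability at most `1 / n`, and the rest is deterministic.

By strong convexity of `log (1 + e^t)` (`sum_sq_le_of_logLik_le`), a maximizer that beats a feasible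
comparison point is at a squared distance controlled by the pairing of their difference with the
score at that point. Operator/nuclear duality bounds the noise part of this pairing, and the nuclear
constraints give it order `n^{3/2}`. For the joint fit the comparison point is the truth, and the
sum-zero constraints isolate `n² (μ̂ - μ⋆)²` (`sq_sub_mean_le`). For the re-fit it is `μ̂ J +
𝒯_β(Z⋆)`, where the score is not centred; the bias is at most 1 at extreme entries and `|μ̂ - μ⋆|`
elsewhere (`avgSqDist_winsorizeMat_le`).

The last two bounds follow entrywise from the splitting into mean error, re-fit error and
winsorization error. -/

namespace LowRankMissing

/-! ### Singular values, the nuclear norm and its duality -/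

open Matrix in
lemma inner_toEuclideanLin_single {n : ℕ} (A B : Matrix (Fin n) (Fin n) ℝ) (j : Fin n) :
    inner ℝ (toEuclideanLin A (EuclideanSpace.single j 1))
      (toEuclideanLin B (EuclideanSpace.single j 1)) = ∑ i, A i j * B i j := by
  simp [PiLp.inner_apply, toLpLin_apply, mul_comm]

/-- The Frobenius inner product can be computed in any orthonormal basis. -/
lemma sum_mul_eq_sum_inner {n : ℕ} (A B : Matrix (Fin n) (Fin n) ℝ)
    (v : OrthonormalBasis (Fin n) ℝ (EuclideanSpace ℝ (Fin n))) :
    ∑ i, ∑ j, A i j * B i j =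
      ∑ k, inner ℝ (Matrix.toEuclideanLin A (v k)) (Matrix.toEuclideanLin B (v k)) := by
  -- Both sides are the trace of `A* B`, which does not depend on the basis.
  have key (w : OrthonormalBasis (Fin n) ℝ (EuclideanSpace ℝ (Fin n))) :
      ∑ k, inner ℝ (Matrix.toEuclideanLin A (w k)) (Matrix.toEuclideanLin B (w k)) =
        LinearMap.trace ℝ _
          (LinearMap.adjoint (Matrix.toEuclideanLin A) ∘ₗ Matrix.toEuclideanLin B) := by
    rw [LinearMap.trace_eq_sum_inner _ w]
    simp [LinearMap.adjoint_inner_right]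
  rw [key v, ← key (EuclideanSpace.basisFun (Fin n) ℝ), Finset.sum_comm]
  simp only [EuclideanSpace.basisFun_apply, inner_toEuclideanLin_single]

/-- A right singular basis: an orthonormal basis whose images have the singular values as norms. -/
lemma exists_orthonormalBasis_norm_eq_singularValues {n : ℕ} (Z : Matrix (Fin n) (Fin n) ℝ) :
    ∃ v : OrthonormalBasis (Fin n) ℝ (EuclideanSpace ℝ (Fin n)), ∀ k : Fin n,
      ‖Matrix.toEuclideanLin Z (v k)‖ = (Matrix.toEuclideanLin Z).singularValues k := by
  set T := Matrix.toEuclideanLin Z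
  have hn : Module.finrank ℝ (EuclideanSpace ℝ (Fin n)) = n := by simp
  refine ⟨T.isSymmetric_adjoint_comp_self.eigenvectorBasis hn, fun k => ?_⟩
  set v := T.isSymmetric_adjoint_comp_self.eigenvectorBasis hn
  have h1 : (LinearMap.adjoint T ∘ₗ T) (v k) =
      (T.isSymmetric_adjoint_comp_self.eigenvalues hn k) • v k := by
    exact T.isSymmetric_adjoint_comp_self.apply_eigenvectorBasis hn k
  have h2 : ‖T (v k)‖ ^ 2 = T.singularValues k ^ 2 := by
    rw [T.sq_singularValues_fin hn, ← real_inner_self_eq_norm_sq, ← LinearMap.adjoint_inner_right]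
    rw [LinearMap.comp_apply] at h1
    rw [h1, real_inner_smul_right, real_inner_self_eq_norm_sq]
    simp
  exact (sq_eq_sq₀ (norm_nonneg _) (T.singularValues_nonneg k)).1 h2

/-- Duality of the operator norm and the nuclear norm. -/
lemma abs_sum_mul_le_nuclearNorm {n : ℕ} {A : Matrix (Fin n) (Fin n) ℝ} {K : ℝ}
    (hA : ∀ x, ‖Matrix.toEuclideanLin A x‖ ≤ K * ‖x‖) (Z : Matrix (Fin n) (Fin n) ℝ) :
    |∑ i, ∑ j, A i j * Z i j| ≤ K * nuclearNorm Z := by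
  obtain ⟨v, hv⟩ := exists_orthonormalBasis_norm_eq_singularValues Z
  rw [sum_mul_eq_sum_inner A Z v, nuclearNorm, Finset.mul_sum, ← Fin.sum_univ_eq_sum_range
    (fun k => K * (Matrix.toEuclideanLin Z).singularValues k)]
  refine (Finset.abs_sum_le_sum_abs _ _).trans (Finset.sum_le_sum fun k _ => ?_)
  refine (abs_real_inner_le_norm _ _).trans ?_
  rw [hv]
  refine mul_le_mul_of_nonneg_right ?_ ((Matrix.toEuclideanLin Z).singularValues_nonneg k)
  simpa using hA (v k)

lemma sum_sq_singularValues {n : ℕ} (Z : Matrix (Fin n) (Fin n) ℝ) :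
    ∑ k ∈ Finset.range n, (Matrix.toEuclideanLin Z).singularValues k ^ 2 =
      ∑ i, ∑ j, Z i j ^ 2 := by
  obtain ⟨v, hv⟩ := exists_orthonormalBasis_norm_eq_singularValues Z
  simp_rw [pow_two (Z _ _)]
  rw [sum_mul_eq_sum_inner Z Z v, ← Fin.sum_univ_eq_sum_range
    (fun k => (Matrix.toEuclideanLin Z).singularValues k ^ 2)]
  simp [← hv]

lemma card_support_singularValues_toEuclideanLin {n : ℕ} (Z : Matrix (Fin n) (Fin n) ℝ) :
    (Matrix.toEuclideanLin Z).singularValues.support.card = Z.rank := by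
  rw [LinearMap.card_support_singularValues, Matrix.rank_eq_finrank_range_toLin Z
    (EuclideanSpace.basisFun (Fin n) ℝ).toBasis (EuclideanSpace.basisFun (Fin n) ℝ).toBasis,
    Matrix.toEuclideanLin_eq_toLin_orthonormal]

/-- Cauchy–Schwarz over the nonzero singular values, of which there are `Z.rank`. -/
lemma nuclearNorm_sq_le {n : ℕ} (Z : Matrix (Fin n) (Fin n) ℝ) :
    nuclearNorm Z ^ 2 ≤ Z.rank * ∑ i, ∑ j, Z i j ^ 2 := by
  set s := (Matrix.toEuclideanLin Z).singularValues with hs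
  have hsub : s.support ⊆ Finset.range n := by
    intro k hk
    by_contra h
    refine (Finsupp.mem_support_iff.1 hk) (LinearMap.singularValues_of_finrank_le _ ?_)
    simpa using h
  have h1 : nuclearNorm Z = ∑ k ∈ s.support, s k :=
    (Finset.sum_subset hsub fun k _ hk => Finsupp.notMem_support_iff.1 hk).symm
  rw [h1, ← sum_sq_singularValues Z, ← card_support_singularValues_toEuclideanLin Z]
  refine sq_sum_le_card_mul_sum_sq.trans (mul_le_mul_of_nonneg_left ?_ (Nat.cast_nonneg _))
  exact Finset.sum_le_sum_of_subset_of_nonneg hsub fun _ _ _ => sq_nonneg _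

/-- This makes `Z⋆` and `𝒯_β(Z⋆)` feasible for the nuclear constraints, hence usable as comparison
points. -/
lemma nuclearNorm_le_of_abs_le {n : ℕ} {Z : Matrix (Fin n) (Fin n) ℝ} {β : ℝ} (hβ : 0 ≤ β)
    (hZ : ∀ i j, |Z i j| ≤ β) : nuclearNorm Z ≤ β * √((Z.rank : ℝ) * n * n) := by
  have h : ∑ i, ∑ j, Z i j ^ 2 ≤ n * (n * β ^ 2) := by
    have : ∑ i, ∑ j, Z i j ^ 2 ≤ ∑ _i : Fin n, ∑ _j : Fin n, β ^ 2 :=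
      Finset.sum_le_sum fun i _ => Finset.sum_le_sum fun j _ =>
        sq_le_sq' (abs_le.1 (hZ i j)).1 (abs_le.1 (hZ i j)).2
    simpa using this
  refine abs_le_of_sq_le_sq' ?_ (by positivity) |>.2
  rw [mul_pow, Real.sq_sqrt (by positivity)]
  nlinarith [nuclearNorm_sq_le Z, mul_le_mul_of_nonneg_left h (Nat.cast_nonneg (α := ℝ) Z.rank)]

/-- The sum is the quadratic form of `A` at the all-ones vector, whose squared norm is `n`. It
handles the `J` direction of the predictor. -/
lemma abs_sum_le_of_norm_toEuclideanLin_le {n : ℕ} {A : Matrix (Fin n) (Fin n) ℝ} {K : ℝ}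
    (hA : ∀ x, ‖Matrix.toEuclideanLin A x‖ ≤ K * ‖x‖) : |∑ i, ∑ j, A i j| ≤ K * n := by
  set x : EuclideanSpace ℝ (Fin n) := WithLp.toLp 2 (fun _ => 1) with hx
  have hx1 : ‖x‖ * ‖x‖ = n := by
    rw [← real_inner_self_eq_norm_mul_norm, PiLp.inner_apply]
    simp [hx]
  have h : ∑ i, ∑ j, A i j = inner ℝ x (Matrix.toEuclideanLin A x) := by
    simp [PiLp.inner_apply, Matrix.toLpLin_apply, hx, Matrix.mulVec, dotProduct]
  rw [h]
  refine (abs_real_inner_le_norm _ _).trans ?_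
  refine (mul_le_mul_of_nonneg_left (hA x) (norm_nonneg x)).trans_eq ?_
  rw [← hx1]
  ring

/-! ### Operator norms through nets -/

/-- The ball of radius `2` has a `1`-net of cardinality at most `5 ^ dim`. -/
lemma exists_net (E : Type*) [NormedAddCommGroup E] [NormedSpace ℝ E] [FiniteDimensional ℝ E] :
    ∃ s : Finset E, (∀ c ∈ s, ‖c‖ ≤ 2) ∧ s.card ≤ 5 ^ Module.finrank ℝ E ∧
      ∀ v : E, ‖v‖ ≤ 2 → ∃ c ∈ s, ‖v - c‖ ≤ 1 := by
  classical
  let S : Set ℕ := {k | ∃ s : Finset E, (∀ c ∈ s, ‖c‖ ≤ 2) ∧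
    (∀ c ∈ s, ∀ d ∈ s, c ≠ d → 1 ≤ ‖c - d‖) ∧ s.card = k}
  have hb : BddAbove S := by
    refine ⟨5 ^ Module.finrank ℝ E, ?_⟩
    rintro k ⟨s, h1, h2, rfl⟩
    exact Besicovitch.card_le_of_separated s h1 h2
  have hne : S.Nonempty := ⟨0, ∅, by simp⟩
  -- A 1-separated set of largest cardinality is a net: any point it missed could be added.
  obtain ⟨s, h1, h2, h3⟩ := Nat.sSup_mem hne hb
  refine ⟨s, h1, Besicovitch.card_le_of_separated s h1 h2, fun v hv => ?_⟩
  by_contra! hcon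
  have hvs : v ∉ s := fun h => by
    have := hcon v h
    simp at this
    linarith
  have hmem : s.card + 1 ∈ S := by
    refine ⟨insert v s, ?_, ?_, Finset.card_insert_of_notMem hvs⟩
    · simpa [hv] using h1
    · intro c hc d hd hcd
      rcases Finset.mem_insert.1 hc with rfl | hc'
      · rcases Finset.mem_insert.1 hd with rfl | hd'
        · exact absurd rfl hcd
        · exact (hcon d hd').le
      · rcases Finset.mem_insert.1 hd with rfl | hd'
        · rw [norm_sub_rev]
          exact (hcon c hc').le
        · exact h2 c hc' d hd' hcd
  have := le_csSup hb hmem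
  omega

/-- Radius 2 keeps the constant at 1: `2u/‖u‖` pairs with `u` to `2‖u‖`, and its replacement by a
net point costs at most `‖u‖`. -/
lemma norm_le_of_net {E : Type*} [NormedAddCommGroup E] [InnerProductSpace ℝ E]
    {s : Finset E} (hs : ∀ v : E, ‖v‖ ≤ 2 → ∃ c ∈ s, ‖v - c‖ ≤ 1) {K : ℝ} {u : E}
    (hu : ∀ c ∈ s, inner ℝ c u ≤ K) : ‖u‖ ≤ K := by
  rcases eq_or_ne u 0 with rfl | h0
  · obtain ⟨c, hc, -⟩ := hs 0 (by simp)
    simpa using hu c hc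
  have hpos : 0 < ‖u‖ := norm_pos_iff.2 h0
  obtain ⟨c, hc, hcv⟩ := hs ((2 / ‖u‖) • u) (by
    rw [norm_smul, Real.norm_of_nonneg (by positivity)]
    field_simp
    exact le_rfl)
  have h1 : inner ℝ ((2 / ‖u‖) • u) u = 2 * ‖u‖ := by
    rw [real_inner_smul_left, real_inner_self_eq_norm_sq]
    field_simp
  have h2 : inner ℝ ((2 / ‖u‖) • u - c) u ≤ 1 * ‖u‖ :=
    (real_inner_le_norm _ _).trans (mul_le_mul_of_nonneg_right hcv hpos.le)
  rw [inner_sub_left, h1] at h2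
  linarith [hu c hc]

/-- A bilinear form that is at most `K` on a `1`-net of the ball of radius `2` has operator norm
at most `K`. -/
lemma norm_apply_le_of_net {E : Type*} [NormedAddCommGroup E] [InnerProductSpace ℝ E]
    [FiniteDimensional ℝ E] {s : Finset E} (hs : ∀ v : E, ‖v‖ ≤ 2 → ∃ c ∈ s, ‖v - c‖ ≤ 1)
    {K : ℝ} (T : E →ₗ[ℝ] E) (hT : ∀ c ∈ s, ∀ d ∈ s, inner ℝ c (T d) ≤ K) (x : E) :
    ‖T x‖ ≤ K * ‖x‖ := by
  have hd : ∀ d ∈ s, ‖T d‖ ≤ K := fun d hd => norm_le_of_net hs fun c hc => hT c hc d hd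
  have hK : 0 ≤ K := by
    obtain ⟨c, hc, -⟩ := hs 0 (by simp)
    exact (norm_nonneg _).trans (hd c hc)
  set L := LinearMap.toContinuousLinearMap T with hL
  -- The norm bounds itself: the net point contributes `K`, the remainder `‖L‖`, and solving gives
  -- `‖L‖ ≤ K`.
  have hbound : ‖L‖ ≤ (K + ‖L‖) / 2 := by
    refine L.opNorm_le_bound (by positivity) fun y => ?_
    rcases eq_or_ne y 0 with rfl | h0
    · simp
    have hpos : 0 < ‖y‖ := norm_pos_iff.2 h0
    obtain ⟨d, hds, hdv⟩ := hs ((2 / ‖y‖) • y) (by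
      rw [norm_smul, Real.norm_of_nonneg (by positivity)]
      field_simp
      exact le_rfl)
    have h1 : ‖L ((2 / ‖y‖) • y)‖ ≤ K + ‖L‖ := by
      have e : L ((2 / ‖y‖) • y) = L d + L ((2 / ‖y‖) • y - d) := by rw [map_sub]; abel
      rw [e]
      refine (norm_add_le _ _).trans (add_le_add (hd d hds) ?_)
      refine (L.le_opNorm _).trans ?_
      nlinarith [norm_nonneg L]
    rw [map_smul, norm_smul, Real.norm_of_nonneg (by positivity), div_mul_eq_mul_div,
      div_le_iff₀ hpos] at h1
    linarith
  refine (L.le_opNorm x).trans (mul_le_mul_of_nonneg_right ?_ (norm_nonneg x))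
  linarith

/-! ### Concentration of the noise matrix -/

lemma HasSubgaussianMGF.mono {Ω : Type*} {mΩ : MeasurableSpace Ω} {P : Measure Ω} {X : Ω → ℝ}
    {c c' : NNReal} (h : HasSubgaussianMGF X c P) (hc : c ≤ c') : HasSubgaussianMGF X c' P where
  integrable_exp_mul := h.integrable_exp_mul
  mgf_le t := by
    refine (h.mgf_le t).trans (Real.exp_le_exp.2 ?_)
    have : (c : ℝ) ≤ c' := hc
    gcongr

section Bernoulli

variable {Ω : Type*} [MeasurableSpace Ω] {P : Measure Ω} [IsProbabilityMeasure P]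

lemma ae_eq_zero_or_one {X : Ω → ℝ} (hX : Measurable X) {θ : ℝ} (h0 : 0 ≤ θ) (h1 : θ ≤ 1)
    (hP1 : P {ω | X ω = 1} = ENNReal.ofReal θ) (hP0 : P {ω | X ω = 0} = ENNReal.ofReal (1 - θ)) :
    ∀ᵐ ω ∂P, X ω = 1 ∨ X ω = 0 := by
  have m1 : MeasurableSet {ω | X ω = 1} := hX (measurableSet_singleton 1)
  have m0 : MeasurableSet {ω | X ω = 0} := hX (measurableSet_singleton 0)
  have hu : P ({ω | X ω = 1} ∪ {ω | X ω = 0}) = 1 := by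
    rw [measure_union _ m0, hP1, hP0, ← ENNReal.ofReal_add h0 (by linarith)]
    · simp
    · rw [Set.disjoint_left]
      intro ω (h : X ω = 1) (h' : X ω = 0)
      linarith
  exact (prob_compl_eq_zero_iff (m1.union m0)).2 hu

omit [IsProbabilityMeasure P] in
lemma integral_eq_of_bernoulli {X : Ω → ℝ} (hX : Measurable X) {θ : ℝ} (h0 : 0 ≤ θ)
    (hP1 : P {ω | X ω = 1} = ENNReal.ofReal θ) (hae : ∀ᵐ ω ∂P, X ω = 1 ∨ X ω = 0) :
    P[X] = θ := by
  have m1 : MeasurableSet {ω | X ω = 1} := hX (measurableSet_singleton 1)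
  have : X =ᵐ[P] Set.indicator {ω | X ω = 1} 1 := by
    filter_upwards [hae] with ω hω
    rcases hω with h | h <;> simp [Set.indicator, h]
  rw [integral_congr_ae this, integral_indicator_one m1, measureReal_def, hP1,
    ENNReal.toReal_ofReal h0]

lemma hasSubgaussianMGF_of_bernoulli {X : Ω → ℝ} (hX : Measurable X) {θ : ℝ} (h0 : 0 ≤ θ)
    (hP1 : P {ω | X ω = 1} = ENNReal.ofReal θ) (hae : ∀ᵐ ω ∂P, X ω = 1 ∨ X ω = 0) :
    HasSubgaussianMGF (fun ω => X ω - θ) 1 P := by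
  have h : HasSubgaussianMGF (fun ω ↦ X ω - P[X]) ((‖(1 : ℝ) - 0‖₊ / 2) ^ 2) P :=
    hasSubgaussianMGF_of_mem_Icc hX.aemeasurable (by
      filter_upwards [hae] with ω hω
      rcases hω with h | h <;> simp [h])
  rw [integral_eq_of_bernoulli hX h0 hP1 hae] at h
  -- Hoeffding's parameter `1/4` is rounded up to 1.
  refine HasSubgaussianMGF.mono h ?_
  rw [sub_zero, nnnorm_one]
  exact pow_le_one₀ (by positivity) (by norm_num)

omit [IsProbabilityMeasure P] in
/-- A Hoeffding tail bound for a bilinear form in a matrix with independent sub-Gaussian entries. -/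
lemma measureReal_inner_ge_le {n : ℕ} {A : Ω → Matrix (Fin n) (Fin n) ℝ}
    (hind : iIndepFun (fun (p : Fin n × Fin n) (ω : Ω) => A ω p.1 p.2) P)
    (hsub : ∀ i j, HasSubgaussianMGF (fun ω => A ω i j) 1 P)
    {c d : EuclideanSpace ℝ (Fin n)} (hc : ‖c‖ ≤ 2) (hd : ‖d‖ ≤ 2) {ε : ℝ} (hε : 0 ≤ ε) :
    P.real {ω | ε ≤ inner ℝ c (Matrix.toEuclideanLin (A ω) d)} ≤ Real.exp (-ε ^ 2 / 32) := by
  have hind' : iIndepFun (fun (p : Fin n × Fin n) (ω : Ω) => (c p.1 * d p.2) * A ω p.1 p.2) P :=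
    hind.comp (fun p x => (c p.1 * d p.2) * x) fun p => measurable_const.mul measurable_id
  have hs := HasSubgaussianMGF.sum_of_iIndepFun hind' (s := Finset.univ)
    (fun p _ => (hsub p.1 p.2).const_mul (c p.1 * d p.2))
  -- The variance proxy is `‖c‖² ‖d‖² ≤ 16`, whence the 32 in the tail.
  have hs' := HasSubgaussianMGF.mono hs (c' := 16) (by
    rw [← NNReal.coe_le_coe]
    push_cast
    have e : ∑ p : Fin n × Fin n, (c p.1 * d p.2) ^ 2 = ‖c‖ ^ 2 * ‖d‖ ^ 2 := by
      rw [EuclideanSpace.real_norm_sq_eq, EuclideanSpace.real_norm_sq_eq, Finset.sum_mul_sum,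
        Fintype.sum_prod_type]
      simp_rw [mul_pow]
    have e' : ‖c‖ ^ 2 * ‖d‖ ^ 2 ≤ 2 ^ 2 * 2 ^ 2 := by gcongr
    have : ∑ p : Fin n × Fin n, (c p.1 * d p.2) ^ 2 ≤ 16 := by rw [e]; linarith
    refine le_trans (Finset.sum_le_sum fun p _ => le_of_eq ?_) this
    exact mul_one _)
  have := hs'.measure_ge_le hε
  convert this using 3
  · ext ω
    have : inner ℝ c (Matrix.toEuclideanLin (A ω) d) =
        ∑ p : Fin n × Fin n, c p.1 * d p.2 * A ω p.1 p.2 := by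
      rw [PiLp.inner_apply, Fintype.sum_prod_type]
      simp only [Matrix.toLpLin_apply, Matrix.mulVec, dotProduct, RCLike.inner_apply, conj_trivial,
        Finset.sum_mul]
      refine Finset.sum_congr rfl fun i _ => Finset.sum_congr rfl fun j _ => by ring
    simp only [this]
  · norm_num

/-- A random matrix with independent sub-Gaussian entries has operator norm at most `16 √n`, up to
an event of probability at most `1 / n`. -/
lemma measure_opNorm_le {n : ℕ} (hn : 1 ≤ n) {A : Ω → Matrix (Fin n) (Fin n) ℝ}
    (hind : iIndepFun (fun (p : Fin n × Fin n) (ω : Ω) => A ω p.1 p.2) P)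
    (hsub : ∀ i j, HasSubgaussianMGF (fun ω => A ω i j) 1 P) :
    P {ω | ¬ ∀ x, ‖Matrix.toEuclideanLin (A ω) x‖ ≤ 16 * √n * ‖x‖} ≤ ENNReal.ofReal (1 / n) := by
  obtain ⟨s, hs2, hcard, hs⟩ := exists_net (EuclideanSpace ℝ (Fin n))
  rw [finrank_euclideanSpace_fin] at hcard
  have hsubset : {ω | ¬ ∀ x, ‖Matrix.toEuclideanLin (A ω) x‖ ≤ 16 * √n * ‖x‖} ⊆
      ⋃ q ∈ s ×ˢ s, {ω | 16 * √n ≤ inner ℝ q.1 (Matrix.toEuclideanLin (A ω) q.2)} := by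
    intro ω hω
    by_contra hcon
    refine hω (norm_apply_le_of_net hs _ fun c hc d hd => ?_)
    simp only [Set.mem_iUnion, not_exists, Set.mem_ofPred_eq, not_le] at hcon
    exact (hcon (c, d) (Finset.mk_mem_product hc hd)).le
  refine (measure_mono hsubset).trans ((measure_biUnion_finset_le _ _).trans ?_)
  -- At level `16 √n` the exponent is `-256 n / 32 = -8n`; the at most `25^n ≤ e^{4n}` pairs leave
  -- `e^{-4n} ≤ 1/n`.
  have hq : ∀ q ∈ s ×ˢ s, P {ω | 16 * √n ≤ inner ℝ q.1 (Matrix.toEuclideanLin (A ω) q.2)} ≤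
      ENNReal.ofReal (Real.exp (-(8 * n))) := by
    intro q hq
    obtain ⟨h1, h2⟩ := Finset.mem_product.1 hq
    rw [← ofReal_measureReal]
    refine ENNReal.ofReal_le_ofReal ((measureReal_inner_ge_le hind hsub (hs2 _ h1) (hs2 _ h2)
      (by positivity)).trans_eq ?_)
    rw [mul_pow, Real.sq_sqrt (Nat.cast_nonneg n)]
    ring_nf
  refine (Finset.sum_le_sum hq).trans ?_
  rw [Finset.sum_const, Finset.card_product, nsmul_eq_mul, ← ENNReal.ofReal_natCast,
    ← ENNReal.ofReal_mul (by positivity)]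
  refine ENNReal.ofReal_le_ofReal ?_
  have hcard' : (s.card : ℝ) ≤ 5 ^ n := by exact_mod_cast hcard
  have h5 : (5 : ℝ) ^ n ≤ Real.exp (2 * n) := by
    rw [mul_comm, Real.exp_nat_mul]
    refine pow_le_pow_left₀ (by norm_num) ?_ n
    -- At `x = 2` the quadratic `1 + x + x²/2` is exactly 5.
    have h2 := Real.quadratic_le_exp_of_nonneg (x := 2) (by norm_num)
    linarith
  have hnpos : (0 : ℝ) < n := by exact_mod_cast hn
  have hexp : (n : ℝ) ≤ Real.exp (4 * n) := by linarith [Real.add_one_le_exp (4 * (n : ℝ))]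
  calc ((s.card * s.card : ℕ) : ℝ) * Real.exp (-(8 * n))
      ≤ (Real.exp (2 * n) * Real.exp (2 * n)) * Real.exp (-(8 * n)) := by
        push_cast
        gcongr <;> exact hcard'.trans h5
    _ = (Real.exp (4 * n))⁻¹ := by rw [← Real.exp_add, ← Real.exp_add, ← Real.exp_neg]; ring_nf
    _ ≤ 1 / n := by rw [one_div]; exact inv_anti₀ hnpos hexp

end Bernoulli

/-! ### Curvature of the logistic log-likelihood -/

lemma log_sigmoid (m : ℝ) : Real.log (Real.sigmoid m) = m - Real.log (1 + Real.exp m) := by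
  have h : Real.sigmoid m = Real.exp m / (1 + Real.exp m) := by
    rw [Real.sigmoid_def, Real.exp_neg]
    field_simp
    ring
  rw [h, Real.log_div (Real.exp_pos m).ne' (by positivity), Real.log_exp]

lemma log_one_sub_sigmoid (m : ℝ) :
    Real.log (1 - Real.sigmoid m) = -Real.log (1 + Real.exp m) := by
  rw [← Real.sigmoid_neg, log_sigmoid, Real.exp_neg]
  have : 1 + (Real.exp m)⁻¹ = (1 + Real.exp m) / Real.exp m := by field_simp; ring
  rw [this, Real.log_div (by positivity) (Real.exp_pos m).ne', Real.log_exp]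
  ring

lemma logLik_eq {n : ℕ} {W : Matrix (Fin n) (Fin n) ℝ} (hW : ∀ i j, W i j = 1 ∨ W i j = 0)
    (M : Matrix (Fin n) (Fin n) ℝ) :
    logLik W M = ∑ i, ∑ j, (W i j * M i j - Real.log (1 + Real.exp (M i j))) := by
  refine Finset.sum_congr rfl fun i _ => Finset.sum_congr rfl fun j _ => ?_
  rcases hW i j with h | h <;> simp [h, log_sigmoid, log_one_sub_sigmoid]

lemma hasDerivAt_log_one_add_exp (m : ℝ) :
    HasDerivAt (fun t => Real.log (1 + Real.exp t)) (Real.sigmoid m) m := by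
  have h := ((Real.hasDerivAt_exp m).const_add 1).log (by positivity)
  convert h using 1
  rw [Real.sigmoid_def, Real.exp_neg]
  field_simp
  ring

/-- Of `f(m)` and `f(-m)`, one is at least `1/2` and the other at least `f(-a) = (1 + e^a)⁻¹`. -/
lemma sigmoid_mul_one_sub_ge {a m : ℝ} (hm : |m| ≤ a) :
    (1 + Real.exp a)⁻¹ / 2 ≤ Real.sigmoid m * (1 - Real.sigmoid m) := by
  have key {t : ℝ} (h0 : 0 ≤ t) (ht : t ≤ a) :
      (1 + Real.exp a)⁻¹ / 2 ≤ Real.sigmoid t * Real.sigmoid (-t) := by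
    have h1 : 2⁻¹ ≤ Real.sigmoid t := Real.sigmoid_zero ▸ Real.sigmoid_le h0
    have h2 : (1 + Real.exp a)⁻¹ ≤ Real.sigmoid (-t) := by
      have := Real.sigmoid_le (neg_le_neg ht)
      rwa [Real.sigmoid_def, neg_neg] at this
    have h3 : 0 < (1 + Real.exp a)⁻¹ := by positivity
    nlinarith
  rw [← Real.sigmoid_neg]
  rcases le_total 0 m with h | h
  · exact key h ((le_abs_self m).trans hm)
  · have := key (neg_nonneg.2 h) ((neg_le_abs m).trans hm)
    rwa [neg_neg, mul_comm] at this

lemma abs_sigmoid_sub_le (x y : ℝ) : |Real.sigmoid x - Real.sigmoid y| ≤ |x - y| := by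
  have h := Convex.norm_image_sub_le_of_norm_hasDerivWithin_le (C := 1) (s := Set.univ)
    (f := Real.sigmoid) (fun z _ => (Real.hasDerivAt_sigmoid z).hasDerivWithinAt)
    (fun z _ => ?_) convex_univ (Set.mem_univ y) (Set.mem_univ x)
  · simpa using h
  · have h1 := Real.sigmoid_pos z
    have h2 := Real.sigmoid_lt_one z
    rw [Real.norm_of_nonneg (by nlinarith)]
    nlinarith

/-- Strong convexity of the log-partition function on `[-a, a]`. -/
lemma log_one_add_exp_sub_ge {a x y : ℝ} (hx : |x| ≤ a) (hy : |y| ≤ a) :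
    (1 + Real.exp a)⁻¹ / 4 * (y - x) ^ 2 ≤
      Real.log (1 + Real.exp y) - Real.log (1 + Real.exp x) - Real.sigmoid x * (y - x) := by
  set c := (1 + Real.exp a)⁻¹ / 2 with hc
  have hx' := abs_le.1 hx
  have hy' := abs_le.1 hy
  let D : Set ℝ := Set.Icc (-a) a
  have hmono : MonotoneOn (fun t => Real.sigmoid t - c * t) D := by
    refine monotoneOn_of_deriv_nonneg (convex_Icc _ _) (by fun_prop) (by fun_prop) fun t ht => ?_
    rw [interior_Icc] at ht
    have hd := (Real.hasDerivAt_sigmoid t).sub ((hasDerivAt_id t).const_mul c)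
    have : HasDerivAt (fun t => Real.sigmoid t - c * t)
      (Real.sigmoid t * (1 - Real.sigmoid t) - c * 1) t := hd
    rw [this.deriv]
    have := sigmoid_mul_one_sub_ge (abs_le.2 ⟨ht.1.le, ht.2.le⟩)
    linarith
  have hder (t : ℝ) : HasDerivAt (fun t => Real.log (1 + Real.exp t) - Real.sigmoid x * t
      - c / 2 * (t - x) ^ 2) (Real.sigmoid t - Real.sigmoid x - c * (t - x)) t := by
    have h1 := ((hasDerivAt_log_one_add_exp t).sub ((hasDerivAt_id t).const_mul
      (Real.sigmoid x))).sub ((((hasDerivAt_id t).sub_const x).pow 2).const_mul (c / 2))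
    refine h1.congr_deriv ?_
    push_cast
    simp only [id]
    ring
  -- The derivative of `φ` vanishes at `x` and, since `f(t) - c t` is increasing, has the sign of `t
  -- - x`; so `x` minimizes `φ` on `[-a, a]`.
  set φ := fun t => Real.log (1 + Real.exp t) - Real.sigmoid x * t - c / 2 * (t - x) ^ 2 with hφ
  have hcont : Continuous φ := continuous_iff_continuousAt.2 fun t => (hder t).continuousAt
  have hφle : φ x ≤ φ y := by
    rcases le_total x y with hxy | hxy
    · refine monotoneOn_of_deriv_nonneg (convex_Icc x y) hcont.continuousOn
        (fun t _ => (hder t).differentiableAt.differentiableWithinAt) (fun t ht => ?_)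
        (Set.left_mem_Icc.2 hxy) (Set.right_mem_Icc.2 hxy) hxy
      rw [interior_Icc] at ht
      rw [(hder t).deriv]
      have := hmono ⟨hx'.1, hx'.2⟩ ⟨hx'.1.trans ht.1.le, ht.2.le.trans hy'.2⟩ ht.1.le
      simp only at this
      linarith
    · refine antitoneOn_of_deriv_nonpos (convex_Icc y x) hcont.continuousOn
        (fun t _ => (hder t).differentiableAt.differentiableWithinAt) (fun t ht => ?_)
        (Set.left_mem_Icc.2 hxy) (Set.right_mem_Icc.2 hxy) hxy
      rw [interior_Icc] at ht
      rw [(hder t).deriv]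
      have := hmono ⟨hy'.1.trans ht.1.le, ht.2.le.trans hx'.2⟩ ⟨hx'.1, hx'.2⟩ ht.2.le
      simp only at this
      linarith
  simp only [hφ, hc] at hφle
  linarith

/-- The basic inequality of maximum likelihood in the logistic model. -/
lemma sum_sq_le_of_logLik_le {n : ℕ} {W M M' : Matrix (Fin n) (Fin n) ℝ} {a : ℝ}
    (hW : ∀ i j, W i j = 1 ∨ W i j = 0) (hM : ∀ i j, |M i j| ≤ a) (hM' : ∀ i j, |M' i j| ≤ a)
    (h : logLik W M ≤ logLik W M') :
    (1 + Real.exp a)⁻¹ / 4 * ∑ i, ∑ j, (M' i j - M i j) ^ 2 ≤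
      ∑ i, ∑ j, (W i j - Real.sigmoid (M i j)) * (M' i j - M i j) := by
  rw [logLik_eq hW, logLik_eq hW] at h
  have key : ∑ i, ∑ j, (1 + Real.exp a)⁻¹ / 4 * (M' i j - M i j) ^ 2 ≤
      ∑ i, ∑ j, ((W i j - Real.sigmoid (M i j)) * (M' i j - M i j)
        - (W i j * M' i j - Real.log (1 + Real.exp (M' i j)))
        + (W i j * M i j - Real.log (1 + Real.exp (M i j)))) := by
    refine Finset.sum_le_sum fun i _ => Finset.sum_le_sum fun j _ => ?_
    linarith [log_one_add_exp_sub_ge (hM i j) (hM' i j)]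
  simp only [Finset.sum_add_distrib, Finset.sum_sub_distrib, ← Finset.mul_sum] at key h ⊢
  linarith

/-! ### Predictors, winsorization and the noise pairing -/

lemma predictor_apply {n : ℕ} (μ : ℝ) (Z : Matrix (Fin n) (Fin n) ℝ) (i j : Fin n) :
    predictor μ Z i j = μ + Z i j := by
  simp [predictor]

lemma abs_predictor_le {n : ℕ} {μ α β : ℝ} {Z : Matrix (Fin n) (Fin n) ℝ} (hμ : |μ| ≤ α)
    (hZ : ∀ i j, |Z i j| ≤ β) (i j : Fin n) : |predictor μ Z i j| ≤ α + β := by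
  rw [predictor_apply]
  exact (abs_add_le _ _).trans (add_le_add hμ (hZ i j))

lemma abs_winsorize_le {β : ℝ} (hβ : 0 ≤ β) (b : ℝ) : |winsorize β b| ≤ β := by
  rw [winsorize, abs_le]
  split_ifs <;> constructor <;> linarith

lemma winsorize_eq_self {β b : ℝ} (h : ¬(b > β ∨ b < -β)) : winsorize β b = b := by
  rw [not_or] at h
  rw [winsorize, if_neg h.1, if_neg h.2]

lemma sq_winsorize_sub_le {α β b : ℝ} (hb : |b| ≤ α) :
    (winsorize β b - b) ^ 2 ≤ max (α - β) 0 ^ 2 := by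
  have hb' := abs_le.1 hb
  have h1 := le_max_left (α - β) 0
  have h2 := le_max_right (α - β) 0
  rw [winsorize]
  refine sq_le_sq' ?_ ?_ <;> split_ifs <;> linarith

lemma sum_ite_extreme {n : ℕ} (β : ℝ) (Z : Matrix (Fin n) (Fin n) ℝ) (a b : ℝ) :
    ∑ i, ∑ j, (if Z i j > β ∨ Z i j < -β then a else b) =
      numExtreme β Z * a + ((n : ℝ) ^ 2 - numExtreme β Z) * b := by
  have h1 : ∑ i, ∑ j, (if Z i j > β ∨ Z i j < -β then a else b) =
      ∑ p : Fin n × Fin n, ((if Z p.1 p.2 > β ∨ Z p.1 p.2 < -β then a - b else 0) + b) := by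
    rw [Fintype.sum_prod_type]
    refine Finset.sum_congr rfl fun i _ => Finset.sum_congr rfl fun j _ => ?_
    split_ifs <;> ring
  rw [h1, Finset.sum_add_distrib, ← Finset.sum_filter, Finset.sum_const, Finset.sum_const]
  simp only [Finset.card_univ, Fintype.card_prod, Fintype.card_fin, nsmul_eq_mul, numExtreme]
  push_cast
  ring

/-- The `J` part is tested on the all-ones vector and `Z`, `Z'` are paired separately, so no nuclear
norm of a difference is needed. -/
lemma sum_noise_mul_le {n : ℕ} {A : Matrix (Fin n) (Fin n) ℝ} {K : ℝ}
    (hA : ∀ x, ‖Matrix.toEuclideanLin A x‖ ≤ K * ‖x‖) (μ μ' : ℝ)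
    (Z Z' : Matrix (Fin n) (Fin n) ℝ) :
    ∑ i, ∑ j, A i j * (predictor μ' Z' i j - predictor μ Z i j) ≤
      K * (n * |μ' - μ| + nuclearNorm Z' + nuclearNorm Z) := by
  have h1 : ∑ i, ∑ j, A i j * (predictor μ' Z' i j - predictor μ Z i j) =
      (μ' - μ) * ∑ i, ∑ j, A i j + ∑ i, ∑ j, A i j * Z' i j - ∑ i, ∑ j, A i j * Z i j := by
    simp only [Finset.mul_sum, ← Finset.sum_add_distrib, ← Finset.sum_sub_distrib, predictor_apply]
    exact Finset.sum_congr rfl fun i _ => Finset.sum_congr rfl fun j _ => by ring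
  have h2 : (μ' - μ) * ∑ i, ∑ j, A i j ≤ |μ' - μ| * (K * n) := by
    refine (le_abs_self _).trans ?_
    rw [abs_mul]
    exact mul_le_mul_of_nonneg_left (abs_sum_le_of_norm_toEuclideanLin_le hA) (abs_nonneg _)
  have h3 := (abs_le.1 (abs_sum_mul_le_nuclearNorm hA Z')).2
  have h4 := (abs_le.1 (abs_sum_mul_le_nuclearNorm hA Z)).1
  rw [h1]
  linarith

lemma sqrt_natCast_mul_mul (r n : ℕ) : √((r : ℝ) * n * n) = √r * n := by
  rw [mul_assoc, Real.sqrt_mul (Nat.cast_nonneg r), Real.sqrt_mul_self (Nat.cast_nonneg n)]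

/-! ### Estimation error on the good event -/

/-- On the event that the noise has small operator norm, the fitted mean is accurate. -/
lemma sq_sub_mean_le {n : ℕ} (hn : 1 ≤ n) {α₁ α₂ μstar : ℝ} {Zstar : Matrix (Fin n) (Fin n) ℝ}
    (hμ : |μstar| ≤ α₁) (hZ : ∀ i j, |Zstar i j| ≤ α₂) (hsum : ∑ i, ∑ j, Zstar i j = 0)
    {W : Matrix (Fin n) (Fin n) ℝ} (hW : ∀ i j, W i j = 1 ∨ W i j = 0)
    (hA : ∀ x, ‖Matrix.toEuclideanLin (W - obsProb (predictor μstar Zstar)) x‖ ≤ 16 * √n * ‖x‖)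
    {μ : ℝ} {Z : Matrix (Fin n) (Fin n) ℝ} (hmle : IsJointMLE Zstar.rank α₁ α₂ W μ Z) :
    (μ - μstar) ^ 2 ≤ 256 * min (α₁ ^ 2) (Gam n α₁ α₂ Zstar) := by
  obtain ⟨⟨hμ1, hZ1, hnuc1, hsum1⟩, hmax⟩ := hmle
  have hα₁ : 0 ≤ α₁ := (abs_nonneg _).trans hμ
  have hα₂ : 0 ≤ α₂ := (abs_nonneg _).trans (hZ ⟨0, hn⟩ ⟨0, hn⟩)
  have hnpos : (0 : ℝ) < n := by exact_mod_cast hn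
  have hnuc := nuclearNorm_le_of_abs_le hα₂ hZ
  simp only at hμ1 hZ1 hnuc1 hsum1
  have hδ : |μ - μstar| ≤ 2 * α₁ := (abs_sub _ _).trans (by linarith)
  rw [mul_min_of_nonneg _ _ (by norm_num : (0 : ℝ) ≤ 256)]
  refine le_min ?_ ?_
  · nlinarith [abs_le.1 hδ, sq_nonneg α₁]
  have hL : logLik W (predictor μstar Zstar) ≤ logLik W (predictor μ Z) :=
    hmax (a := (μstar, Zstar)) ⟨hμ, hZ, hnuc, hsum⟩
  have hbasic := sum_sq_le_of_logLik_le hW (abs_predictor_le hμ hZ) (abs_predictor_le hμ1 hZ1) hL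
  have hnoise := sum_noise_mul_le hA μstar μ Zstar Z
  have hle := hbasic.trans hnoise
  -- The cross term vanishes because `Z` and `Zstar` both sum to zero; the square of `Z - Zstar` is
  -- dropped.
  have hsq : ∑ i, ∑ j, (predictor μ Z i j - predictor μstar Zstar i j) ^ 2 ≥
      n ^ 2 * (μ - μstar) ^ 2 := by
    have : ∑ i, ∑ j, (predictor μ Z i j - predictor μstar Zstar i j) ^ 2 ≥
        ∑ i, ∑ j, ((μ - μstar) ^ 2 + 2 * (μ - μstar) * (Z i j - Zstar i j)) := by
      refine Finset.sum_le_sum fun i _ => Finset.sum_le_sum fun j _ => ?_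
      rw [predictor_apply, predictor_apply]
      nlinarith [sq_nonneg (Z i j - Zstar i j)]
    simp only [Finset.sum_add_distrib, ← Finset.mul_sum, Finset.sum_sub_distrib, hsum, hsum1] at this
    simp only [Finset.sum_const, Finset.card_univ, Fintype.card_fin, nsmul_eq_mul] at this
    linarith
  rw [sqrt_natCast_mul_mul] at hnuc hnuc1
  set r := √(Zstar.rank : ℝ) with hr
  set s := √(n : ℝ) with hs
  have hs2 : s * s = n := Real.mul_self_sqrt hnpos.le
  have hspos : 0 < s := Real.sqrt_pos.2 hnpos
  have hrhs : 16 * s * (n * |μ - μstar| + nuclearNorm Z + nuclearNorm Zstar) ≤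
      32 * s * n * (α₁ + α₂ * r) := by
    have h1 : n * |μ - μstar| ≤ n * (2 * α₁) := mul_le_mul_of_nonneg_left hδ hnpos.le
    have : n * |μ - μstar| + nuclearNorm Z + nuclearNorm Zstar ≤ 2 * n * (α₁ + α₂ * r) := by
      linarith
    nlinarith
  -- This replaces `1 + e^{α₁+α₂}` by the exponential in `Gam`; the final 256 is `2 · 4 · 32`.
  have hexp : 1 + Real.exp (α₁ + α₂) ≤ 2 * Real.exp (α₁ + α₂) := by
    linarith [Real.one_le_exp (add_nonneg hα₁ hα₂)]
  set e := Real.exp (α₁ + α₂) with he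
  have hepos : 0 < e := Real.exp_pos _
  have h2 : (1 + e)⁻¹ / 4 * (n ^ 2 * (μ - μstar) ^ 2) ≤ 32 * s * n * (α₁ + α₂ * r) :=
    (mul_le_mul_of_nonneg_left hsq (by positivity)).trans (hle.trans hrhs)
  have h3 : n ^ 2 * (μ - μstar) ^ 2 ≤ (1 + e) * 4 * (32 * s * n * (α₁ + α₂ * r)) := by
    have := mul_le_mul_of_nonneg_left h2 (by positivity : 0 ≤ (1 + e) * 4)
    refine le_trans (le_of_eq ?_) this
    field_simp
  have hX : 0 ≤ α₁ + α₂ * r := by positivity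
  have h4 : n ^ 2 * (μ - μstar) ^ 2 ≤ 256 * e * s * n * (α₁ + α₂ * r) := by
    refine h3.trans ?_
    have := mul_le_mul_of_nonneg_right hexp (by positivity : 0 ≤ 4 * (32 * s * n * (α₁ + α₂ * r)))
    linarith
  have h5 : n ^ 2 * (256 * (e * (α₁ + α₂ * r) / s)) = 256 * e * s * n * (α₁ + α₂ * r) := by
    rw [← hs2]
    field_simp
  rw [Gam, ← hr, ← hs, ← he]
  rw [← h5] at h4
  exact le_of_mul_le_mul_left h4 (by positivity)

lemma hCoef_pos (α β : ℝ) : 0 < hCoef α β := by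
  rw [hCoef]
  positivity

/-- On the event that the noise has small operator norm, the re-estimate is accurate. -/
lemma avgSqDist_winsorizeMat_le {n : ℕ} (hn : 1 ≤ n) {α₁ β μstar : ℝ} (hβ : 0 ≤ β)
    {Zstar : Matrix (Fin n) (Fin n) ℝ} (hα₁ : 0 ≤ α₁)
    {W : Matrix (Fin n) (Fin n) ℝ} (hW : ∀ i j, W i j = 1 ∨ W i j = 0)
    (hA : ∀ x, ‖Matrix.toEuclideanLin (W - obsProb (predictor μstar Zstar)) x‖ ≤ 16 * √n * ‖x‖)
    {μ : ℝ} (hμ : |μ| ≤ α₁) {Z : Matrix (Fin n) (Fin n) ℝ}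
    (hmle : IsReMLE (winsorizeMat β Zstar).rank β W μ Z) :
    avgSqDist Z (winsorizeMat β Zstar) ≤ 128 * Lam n α₁ β μstar μ Zstar := by
  obtain ⟨⟨hZ1, hnuc1⟩, hmax⟩ := hmle
  have hnpos : (0 : ℝ) < n := by exact_mod_cast hn
  set T := winsorizeMat β Zstar with hT
  have hTapp (i j : Fin n) : T i j = winsorize β (Zstar i j) := rfl
  have hT1 : ∀ i j, |T i j| ≤ β := fun i j => abs_winsorize_le hβ _
  have hnuc := nuclearNorm_le_of_abs_le hβ hT1
  have hdiff (i j : Fin n) : |Z i j - T i j| ≤ 2 * β :=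
    (abs_sub _ _).trans (by linarith [hZ1 i j, hT1 i j])
  rw [Lam, mul_min_of_nonneg _ _ (by norm_num : (0 : ℝ) ≤ 128), avgSqDist]
  refine le_min ?_ ?_
  · rw [div_le_iff₀ (by positivity)]
    have : ∑ i, ∑ j, (Z i j - T i j) ^ 2 ≤ ∑ _i : Fin n, ∑ _j : Fin n, 128 * β ^ 2 := by
      refine Finset.sum_le_sum fun i _ => Finset.sum_le_sum fun j _ => ?_
      nlinarith [abs_le.1 (hdiff i j), sq_nonneg β]
    simp only [Finset.sum_const, Finset.card_univ, Fintype.card_fin, nsmul_eq_mul] at this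
    linarith
  have hL : logLik W (predictor μ T) ≤ logLik W (predictor μ Z) := hmax (a := T) ⟨hT1, hnuc⟩
  have hbasic := sum_sq_le_of_logLik_le hW (abs_predictor_le hμ hT1) (abs_predictor_le hμ hZ1) hL
  have hnoise := sum_noise_mul_le hA μ μ T Z
  rw [sub_self, abs_zero, mul_zero, zero_add] at hnoise
  -- Extreme entries use only that two probabilities differ by at most 1. Elsewhere winsorizing
  -- changes nothing, so the predictors differ by `μstar - μ` and the sigmoid is 1-Lipschitz.
  have hbias : ∑ i, ∑ j, (Real.sigmoid (predictor μstar Zstar i j) -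
      Real.sigmoid (predictor μ T i j)) * (predictor μ Z i j - predictor μ T i j) ≤
      numExtreme β Zstar * (2 * β) +
        ((n : ℝ) ^ 2 - numExtreme β Zstar) * (2 * β * |μstar - μ|) := by
    rw [← sum_ite_extreme]
    refine Finset.sum_le_sum fun i _ => Finset.sum_le_sum fun j _ => ?_
    refine (le_abs_self _).trans ?_
    have hz : predictor μ Z i j - predictor μ T i j = Z i j - T i j := by
      simp only [predictor_apply]
      ring
    rw [abs_mul, hz]
    split_ifs with hex
    · have : |Real.sigmoid (predictor μstar Zstar i j) - Real.sigmoid (predictor μ T i j)| ≤ 1 := by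
        rw [abs_le]
        constructor <;> linarith [Real.sigmoid_pos (predictor μstar Zstar i j),
          Real.sigmoid_pos (predictor μ T i j), Real.sigmoid_lt_one (predictor μstar Zstar i j),
          Real.sigmoid_lt_one (predictor μ T i j)]
      exact (mul_le_mul this (hdiff i j) (abs_nonneg _) zero_le_one).trans_eq (one_mul _)
    · have h1 := abs_sigmoid_sub_le (predictor μstar Zstar i j) (predictor μ T i j)
      rw [predictor_apply, predictor_apply, hTapp, winsorize_eq_self hex, add_sub_add_right_eq_sub]
        at h1
      rw [predictor_apply, predictor_apply, hTapp, winsorize_eq_self hex, mul_comm (2 * β)]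
      have h2 := hdiff i j
      rw [hTapp, winsorize_eq_self hex] at h2
      exact mul_le_mul h1 h2 (abs_nonneg _) (abs_nonneg _)
  have hsplit : ∑ i, ∑ j, (W i j - Real.sigmoid (predictor μ T i j)) *
        (predictor μ Z i j - predictor μ T i j) =
      ∑ i, ∑ j, (W - obsProb (predictor μstar Zstar)) i j *
        (predictor μ Z i j - predictor μ T i j) +
      ∑ i, ∑ j, (Real.sigmoid (predictor μstar Zstar i j) -
        Real.sigmoid (predictor μ T i j)) * (predictor μ Z i j - predictor μ T i j) := by
    simp only [← Finset.sum_add_distrib]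
    refine Finset.sum_congr rfl fun i _ => Finset.sum_congr rfl fun j _ => ?_
    simp only [Matrix.sub_apply, obsProb, Matrix.map_apply]
    ring
  have hsq : ∑ i, ∑ j, (predictor μ Z i j - predictor μ T i j) ^ 2 =
      ∑ i, ∑ j, (Z i j - T i j) ^ 2 := by
    simp only [predictor_apply, add_sub_add_left_eq_sub]
  rw [hsplit, hsq] at hbasic
  rw [sqrt_natCast_mul_mul] at hnuc hnuc1
  rw [GamTilde, ← hT]
  have hN : (numExtreme β Zstar : ℝ) ≤ (n : ℝ) ^ 2 := by
    have : numExtreme β Zstar ≤ Fintype.card (Fin n × Fin n) := Finset.card_le_univ _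
    rw [Fintype.card_prod, Fintype.card_fin, ← pow_two] at this
    exact_mod_cast this
  have hh : (1 + Real.exp (α₁ + β))⁻¹ = hCoef α₁ β := rfl
  rw [hh] at hbasic
  have hhpos := hCoef_pos α₁ β
  set h := hCoef α₁ β
  set N := (numExtreme β Zstar : ℝ)
  have hN0 : 0 ≤ N := Nat.cast_nonneg _
  set r := √(T.rank : ℝ) with hr
  set s := √(n : ℝ) with hs
  have hs2 : s * s = n := Real.mul_self_sqrt hnpos.le
  have hspos : 0 < s := Real.sqrt_pos.2 hnpos
  have hX : 0 ≤ ((n : ℝ) ^ 2 - N) * |μstar - μ| :=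
    mul_nonneg (sub_nonneg.2 hN) (abs_nonneg _)
  -- Both predictors share `μ`, so the `α₁` term is slack here, as is most of the factor on the
  -- bias; the factor 128 is `4 · 32`.
  have h1 : h / 4 * ∑ i, ∑ j, (Z i j - T i j) ^ 2 ≤ 32 * s * n * (α₁ + β * r) +
      32 * (β * (8 * N + (n ^ 2 - N) * |μstar - μ|)) := by
    have e1 : 16 * s * (nuclearNorm Z + nuclearNorm T) ≤ 16 * s * (2 * (β * (r * n))) :=
      mul_le_mul_of_nonneg_left (by linarith) (by positivity)
    have e2 : 0 ≤ 32 * s * n * α₁ := by positivity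
    have e3 := mul_nonneg hβ hX
    have e4 := mul_nonneg hβ hN0
    linarith
  rw [div_le_iff₀ (by positivity)]
  have h2 := mul_le_mul_of_nonneg_left h1 (by positivity : 0 ≤ 4 * h⁻¹)
  refine (le_of_eq ?_).trans (h2.trans (le_of_eq ?_))
  · field_simp
  · have hn2 : (n : ℝ) = s ^ 2 := by rw [pow_two, hs2]
    rw [hn2]
    field_simp
    ring

/-! ### Transfer to predictors and inverse probabilities -/

/-- Entrywise decomposition of the error of the fitted predictor. -/
lemma avgSqDist_predictor_le {n : ℕ} (hn : 1 ≤ n) {α₂ β μstar μ : ℝ}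
    {Zstar Z : Matrix (Fin n) (Fin n) ℝ} (hZ : ∀ i j, |Zstar i j| ≤ α₂) :
    avgSqDist (predictor μ Z) (predictor μstar Zstar) ≤
      4 * (μ - μstar) ^ 2 + 4 * avgSqDist Z (winsorizeMat β Zstar) +
        2 * max (α₂ - β) 0 ^ 2 * numExtreme β Zstar / (n : ℝ) ^ 2 := by
  have hnpos : (0 : ℝ) < n := by exact_mod_cast hn
  have h : ∑ i, ∑ j, (predictor μ Z i j - predictor μstar Zstar i j) ^ 2 ≤
      ∑ i, ∑ j, (4 * (μ - μstar) ^ 2 + 4 * (Z i j - winsorizeMat β Zstar i j) ^ 2 +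
        if Zstar i j > β ∨ Zstar i j < -β then 2 * max (α₂ - β) 0 ^ 2 else 0) := by
    refine Finset.sum_le_sum fun i _ => Finset.sum_le_sum fun j _ => ?_
    have hT : winsorizeMat β Zstar i j = winsorize β (Zstar i j) := rfl
    rw [predictor_apply, predictor_apply, hT]
    have key := sq_winsorize_sub_le (β := β) (hZ i j)
    have e : μ + Z i j - (μstar + Zstar i j) = ((μ - μstar) + (Z i j - winsorize β (Zstar i j))) +
      (winsorize β (Zstar i j) - Zstar i j) := by ring
    -- Peeling off the winsorization error first gives it factor 2 and leaves 4 on the other two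
    -- errors.
    have hab := add_sq_le (a := (μ - μstar) + (Z i j - winsorize β (Zstar i j)))
      (b := winsorize β (Zstar i j) - Zstar i j)
    have hab' := add_sq_le (a := μ - μstar) (b := Z i j - winsorize β (Zstar i j))
    rw [e]
    split_ifs with hex
    · linarith
    · rw [winsorize_eq_self hex, sub_self] at hab ⊢
      rw [winsorize_eq_self hex] at hab'
      linarith
  simp only [Finset.sum_add_distrib, ← Finset.mul_sum] at h
  rw [sum_ite_extreme] at h
  simp only [Finset.sum_const, Finset.card_univ, Fintype.card_fin, nsmul_eq_mul] at h
  rw [avgSqDist, avgSqDist, div_le_iff₀ (by positivity)]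
  refine h.trans (le_of_eq ?_)
  field_simp
  ring

lemma inv_sigmoid (m : ℝ) : (Real.sigmoid m)⁻¹ = 1 + Real.exp (-m) := by
  rw [Real.sigmoid_def, inv_inv]

/-- Since `1/f(m) = 1 + e^{-m}`, the slope is at most `e^a`; it is enlarged to `1 + e^a` so as to
equal `h⁻¹`. -/
lemma abs_inv_sigmoid_sub_le {a x y : ℝ} (hx : |x| ≤ a) (hy : |y| ≤ a) :
    |(Real.sigmoid x)⁻¹ - (Real.sigmoid y)⁻¹| ≤ (1 + Real.exp a) * |x - y| := by
  have h := Convex.norm_image_sub_le_of_norm_hasDerivWithin_le (C := 1 + Real.exp a)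
    (s := Set.Icc (-a) a) (f := fun t => 1 + Real.exp (-t)) (f' := fun t => Real.exp (-t) * -1)
    (fun z _ => (((hasDerivAt_neg z).exp).const_add 1).hasDerivWithinAt)
    (fun z hz => ?_) (convex_Icc _ _) (abs_le.1 hy) (abs_le.1 hx)
  · rw [inv_sigmoid, inv_sigmoid]
    exact h
  · have : Real.exp (-z) ≤ Real.exp a := Real.exp_le_exp.2 (by linarith [hz.1])
    rw [mul_neg_one, norm_neg, Real.norm_of_nonneg (Real.exp_pos _).le]
    linarith

/-- Entrywise decomposition of the error of the inverse observation probabilities. -/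
lemma avgSqDist_entrywiseInv_le {n : ℕ} (hn : 1 ≤ n) {α₁ β μstar μ θL : ℝ} (hβ : 0 ≤ β)
    {Zstar Z : Matrix (Fin n) (Fin n) ℝ} (hμstar : |μstar| ≤ α₁) (hμ : |μ| ≤ α₁)
    (hsum : ∑ i, ∑ j, Zstar i j = 0) (hZ : ∀ i j, |Z i j| ≤ β) (hθ : 0 < θL)
    (hθL : ∀ i j, θL ≤ obsProb (predictor μstar Zstar) i j) :
    avgSqDist (entrywiseInv (obsProb (predictor μ Z)))
        (entrywiseInv (obsProb (predictor μstar Zstar))) ≤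
      (4 * (μ - μstar) ^ 2 + 4 * avgSqDist Z (winsorizeMat β Zstar)) / hCoef α₁ β ^ 2 +
        8 * numExtreme β Zstar / ((n : ℝ) ^ 2 * θL ^ 2) := by
  have hnpos : (0 : ℝ) < n := by exact_mod_cast hn
  have hinv (i j : Fin n) : (Real.sigmoid (μstar + Zstar i j))⁻¹ ≤ θL⁻¹ := by
    have := hθL i j
    rw [obsProb, Matrix.map_apply, predictor_apply] at this
    exact inv_anti₀ hθ this
  -- A sum-zero matrix has an entry that is at most 0, so `f(μstar)` dominates an observation
  -- probability.
  have hmean : (Real.sigmoid μstar)⁻¹ ≤ θL⁻¹ := by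
    obtain ⟨i, j, hij⟩ : ∃ i j, Zstar i j ≤ 0 := by
      by_contra! hcon
      have hpos : 0 < ∑ i, ∑ j, Zstar i j :=
        Finset.sum_pos (fun i _ => Finset.sum_pos (fun j _ => hcon i j) ⟨⟨0, hn⟩, by simp⟩)
          ⟨⟨0, hn⟩, by simp⟩
      exact hpos.ne' hsum
    exact (inv_anti₀ (Real.sigmoid_pos _) (Real.sigmoid_le (by linarith))).trans (hinv i j)
  have hhpos := hCoef_pos α₁ β
  have h : ∑ i, ∑ j, (entrywiseInv (obsProb (predictor μ Z)) i j -
        entrywiseInv (obsProb (predictor μstar Zstar)) i j) ^ 2 ≤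
      ∑ i, ∑ j, ((hCoef α₁ β)⁻¹ ^ 2 * (4 * (μ - μstar) ^ 2) +
        (hCoef α₁ β)⁻¹ ^ 2 * 4 * (Z i j - winsorizeMat β Zstar i j) ^ 2 +
        if Zstar i j > β ∨ Zstar i j < -β then 8 * θL⁻¹ ^ 2 else 0) := by
    refine Finset.sum_le_sum fun i _ => Finset.sum_le_sum fun j _ => ?_
    have hT : winsorizeMat β Zstar i j = winsorize β (Zstar i j) := rfl
    simp only [entrywiseInv, obsProb, Matrix.map_apply, predictor_apply, hT]
    have hhe : 1 + Real.exp (α₁ + β) = (hCoef α₁ β)⁻¹ := by rw [hCoef, inv_inv]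
    set w := winsorize β (Zstar i j) with hw
    have hwβ : |w| ≤ β := abs_winsorize_le hβ _
    have hlip := abs_inv_sigmoid_sub_le (x := μ + Z i j) (y := μstar + w)
      ((abs_add_le _ _).trans (add_le_add hμ (hZ i j)))
      ((abs_add_le _ _).trans (add_le_add hμstar hwβ))
    rw [hhe] at hlip
    have hlip2 : ((Real.sigmoid (μ + Z i j))⁻¹ - (Real.sigmoid (μstar + w))⁻¹) ^ 2 ≤
        (hCoef α₁ β)⁻¹ ^ 2 * (2 * (μ - μstar) ^ 2 + 2 * (Z i j - w) ^ 2) := by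
      have h1 := pow_le_pow_left₀ (abs_nonneg _) hlip 2
      rw [sq_abs, mul_pow, sq_abs] at h1
      refine h1.trans (mul_le_mul_of_nonneg_left ?_ (by positivity))
      have hab := add_sq_le (a := μ - μstar) (b := Z i j - w)
      have e : μ + Z i j - (μstar + w) = μ - μstar + (Z i j - w) := by ring
      rw [e]
      linarith
    have hab := add_sq_le
      (a := (Real.sigmoid (μ + Z i j))⁻¹ - (Real.sigmoid (μstar + w))⁻¹)
      (b := (Real.sigmoid (μstar + w))⁻¹ - (Real.sigmoid (μstar + Zstar i j))⁻¹)
    rw [sub_add_sub_cancel] at hab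
    have hext : 2 * ((Real.sigmoid (μstar + w))⁻¹ - (Real.sigmoid (μstar + Zstar i j))⁻¹) ^ 2 ≤
        if Zstar i j > β ∨ Zstar i j < -β then 8 * θL⁻¹ ^ 2 else 0 := by
      split_ifs with hex
      · have hp1 := inv_pos.2 (Real.sigmoid_pos (μstar + w))
        have hp2 := inv_pos.2 (Real.sigmoid_pos (μstar + Zstar i j))
        -- Winsorizing moves an entry towards 0: from above it stops at `β ≥ 0`, where `hmean`
        -- applies; from below it raises the probability.
        have hw1 : (Real.sigmoid (μstar + w))⁻¹ ≤ θL⁻¹ := by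
          by_cases hgt : Zstar i j > β
          · have hwe : w = β := by rw [hw, winsorize, if_pos hgt]
            exact (inv_anti₀ (Real.sigmoid_pos _) (Real.sigmoid_le (by linarith))).trans hmean
          · have hlt := hex.resolve_left hgt
            have hwe : w = -β := by rw [hw, winsorize, if_neg hgt, if_pos hlt]
            exact (inv_anti₀ (Real.sigmoid_pos _) (Real.sigmoid_le (by linarith))).trans (hinv i j)
        have hw2 := hinv i j
        have : ((Real.sigmoid (μstar + w))⁻¹ - (Real.sigmoid (μstar + Zstar i j))⁻¹) ^ 2 ≤
            θL⁻¹ ^ 2 := sq_le_sq' (by linarith) (by linarith)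
        linarith [sq_nonneg θL⁻¹]
      · have hwe : w = Zstar i j := winsorize_eq_self hex
        rw [hwe]
        simp
    linarith
  simp only [Finset.sum_add_distrib, ← Finset.mul_sum] at h
  rw [sum_ite_extreme] at h
  simp only [Finset.sum_const, Finset.card_univ, Fintype.card_fin, nsmul_eq_mul] at h
  rw [avgSqDist, avgSqDist, div_le_iff₀ (by positivity)]
  refine h.trans (le_of_eq ?_)
  field_simp
  ring

end LowRankMissing

/-! ### Assembly -/

theorem mainTheorem2 :
    ∃ C₁ C₂ C₃ : ℝ, 0 < C₁ ∧ 0 < C₂ ∧ 0 < C₃ ∧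
      ∀ (n : ℕ) (_ : 1 ≤ n) (α₁ α₂ β : ℝ) (_ : 0 ≤ β)
        -- the hidden parameters, `M⋆ = μ⋆ J + Z⋆`
        (μstar : ℝ) (Zstar : Matrix (Fin n) (Fin n) ℝ)
        (_ : |μstar| ≤ α₁) (_ : ∀ i j, |Zstar i j| ≤ α₂) (_ : ∑ i, ∑ j, Zstar i j = 0)
        -- a positive lower bound for the observation probabilities
        (θL : ℝ) (_ : 0 < θL)
        (_ : ∀ i j, θL ≤ LowRankMissing.obsProb (LowRankMissing.predictor μstar Zstar) i j)
        -- independent Bernoulli indicators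
        (Ω : Type*) (_ : MeasurableSpace Ω) (P : Measure Ω) (_ : IsProbabilityMeasure P)
        (W : Ω → Matrix (Fin n) (Fin n) ℝ)
        (_ : ∀ i j, Measurable (fun ω => W ω i j))
        (_ : iIndepFun (fun (p : Fin n × Fin n) (ω : Ω) => W ω p.1 p.2) P)
        (_ : ∀ i j, P {ω | W ω i j = 1} = ENNReal.ofReal
          (LowRankMissing.obsProb (LowRankMissing.predictor μstar Zstar) i j))
        (_ : ∀ i j, P {ω | W ω i j = 0} = ENNReal.ofReal
          (1 - LowRankMissing.obsProb (LowRankMissing.predictor μstar Zstar) i j))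
        -- the estimators
        (μhat : Ω → ℝ) (Zhat Zhatβ : Ω → Matrix (Fin n) (Fin n) ℝ)
        (_ : ∀ ω, LowRankMissing.IsJointMLE Zstar.rank α₁ α₂ (W ω) (μhat ω) (Zhat ω))
        (_ : ∀ ω, LowRankMissing.IsReMLE (LowRankMissing.winsorizeMat β Zstar).rank β
          (W ω) (μhat ω) (Zhatβ ω)),
        ENNReal.ofReal (1 - 2 * C₁ / n) ≤
          P {ω |
            LowRankMissing.avgSqDist (Zhatβ ω) (LowRankMissing.winsorizeMat β Zstar)
              ≤ C₃ * LowRankMissing.Lam n α₁ β μstar (μhat ω) Zstar ∧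
            LowRankMissing.avgSqDist (LowRankMissing.predictor (μhat ω) (Zhatβ ω))
                (LowRankMissing.predictor μstar Zstar)
              ≤ C₂ * min (α₁ ^ 2) (LowRankMissing.Gam n α₁ α₂ Zstar)
                + C₃ * LowRankMissing.Lam n α₁ β μstar (μhat ω) Zstar
                + 2 * (max (α₂ - β) 0) ^ 2 * (LowRankMissing.numExtreme β Zstar : ℝ)
                    / (n : ℝ) ^ 2 ∧
            LowRankMissing.avgSqDist
                (LowRankMissing.entrywiseInv (LowRankMissing.obsProb
                  (LowRankMissing.predictor (μhat ω) (Zhatβ ω))))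
                (LowRankMissing.entrywiseInv (LowRankMissing.obsProb
                  (LowRankMissing.predictor μstar Zstar)))
              ≤ C₂ / (LowRankMissing.hCoef α₁ β) ^ 2
                  * min (α₁ ^ 2) (LowRankMissing.Gam n α₁ α₂ Zstar)
                + C₃ * LowRankMissing.Lam n α₁ β μstar (μhat ω) Zstar
                    / (LowRankMissing.hCoef α₁ β) ^ 2
                + 8 * (LowRankMissing.numExtreme β Zstar : ℝ) / ((n : ℝ) ^ 2 * θL ^ 2)} := by
  -- `1024 = 4 · 256` and `512 = 4 · 128`, the 4 coming from the entrywise splittings; the failure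
  -- probability is in fact at most `1/n`.
  refine ⟨1, 1024, 512, by norm_num, by norm_num, by norm_num, ?_⟩
  intro n hn α₁ α₂ β hβ μstar Zstar hμ hZ hsum θL hθ hθL Ω _ P _ W hWm hind hP1 hP0 μhat Zhat Zhatβ
    hmle hre
  set Θ := LowRankMissing.obsProb (LowRankMissing.predictor μstar Zstar) with hΘ
  have hΘ0 (i j : Fin n) : 0 ≤ Θ i j := Real.sigmoid_nonneg _
  have hΘ1 (i j : Fin n) : Θ i j ≤ 1 := Real.sigmoid_le_one _
  have hα₁ : 0 ≤ α₁ := (abs_nonneg _).trans hμ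
  have hae (i j : Fin n) : ∀ᵐ ω ∂P, W ω i j = 1 ∨ W ω i j = 0 :=
    LowRankMissing.ae_eq_zero_or_one (hWm i j) (hΘ0 i j) (hΘ1 i j) (hP1 i j) (hP0 i j)
  have hnull : P {ω | ¬ ∀ i j, W ω i j = 1 ∨ W ω i j = 0} = 0 :=
    ae_iff.1 (ae_all_iff.2 fun i => ae_all_iff.2 fun j => hae i j)
  have hop := LowRankMissing.measure_opNorm_le (P := P) hn (A := fun ω => W ω - Θ)
    (hind.comp (fun p x => x - Θ p.1 p.2) fun p => measurable_id.sub_const _)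
    (fun i j => LowRankMissing.hasSubgaussianMGF_of_bernoulli (hWm i j) (hΘ0 i j) (hP1 i j)
      (hae i j))
  set bad := {ω | ¬ ∀ i j, W ω i j = 1 ∨ W ω i j = 0} ∪
    {ω | ¬ ∀ x, ‖Matrix.toEuclideanLin (W ω - Θ) x‖ ≤ 16 * √n * ‖x‖} with hbad
  have hPbad : P bad ≤ ENNReal.ofReal (1 / n) := by
    refine (measure_union_le _ _).trans ?_
    rw [hnull, zero_add]
    exact hop
  have hcompl : ENNReal.ofReal (1 - 2 * 1 / n) ≤ P badᶜ := by
    -- Subadditivity suffices, so measurability of `bad` is not needed.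
    have h1 : 1 ≤ P bad + P badᶜ := by
      rw [← measure_univ (μ := P), ← Set.union_compl_self bad]
      exact measure_union_le _ _
    have h2 : ENNReal.ofReal (1 - 2 * 1 / n) ≤ 1 - ENNReal.ofReal (1 / n) := by
      rw [← ENNReal.ofReal_one, ← ENNReal.ofReal_sub _ (by positivity)]
      refine ENNReal.ofReal_le_ofReal ?_
      have : (0 : ℝ) ≤ 1 / n := by positivity
      rw [mul_one, ← mul_one_div]
      linarith
    refine h2.trans (tsub_le_iff_left.2 (h1.trans ?_))
    gcongr
  refine hcompl.trans (measure_mono fun ω hω => ?_)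
  simp only [hbad, Set.mem_compl_iff, Set.mem_union, not_or, Set.mem_ofPred_eq, not_not] at hω
  obtain ⟨hW, hA⟩ := hω
  have hμhat : |μhat ω| ≤ α₁ := (hmle ω).1.1
  have hZβ : ∀ i j, |Zhatβ ω i j| ≤ β := (hre ω).1.1
  have hmean := LowRankMissing.sq_sub_mean_le hn hμ hZ hsum hW hA (hmle ω)
  have hest := LowRankMissing.avgSqDist_winsorizeMat_le hn hβ hα₁ hW hA hμhat (hre ω)
  have hdist : 0 ≤ LowRankMissing.avgSqDist (Zhatβ ω) (LowRankMissing.winsorizeMat β Zstar) := by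
    rw [LowRankMissing.avgSqDist]
    positivity
  refine ⟨by linarith, ?_, ?_⟩
  · refine (LowRankMissing.avgSqDist_predictor_le (β := β) hn hZ).trans ?_
    linarith
  · refine (LowRankMissing.avgSqDist_entrywiseInv_le hn hβ hμ hμhat hsum hZβ hθ hθL).trans ?_
    have hpos := LowRankMissing.hCoef_pos α₁ β
    rw [div_mul_eq_mul_div, ← add_div]
    exact add_le_add (div_le_div_of_nonneg_right (by linarith) (by positivity)) le_rfl
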